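/- Let $(X,\|\cdot\|)$ be a Banach space. For $2\le q<\infty$, $X$ has (Rademacher) cotype $q$ if there is a finite $C\ge 0$ such that $$\sum_{j=1}^m\|x_j\|^q\le C^q\,\mathbb E\Big\|\sum_{j=1}^m\varepsilon_jx_j\Big\|^q$$ for all $m\ge 1$ and $x_1,\dots,x_m\in X$, where $\varepsilon_1,\dots,\varepsilon_m$ are independent uniform random signs; the best such constant $C$ is denoted $C_q(X)$. For $f:\{-1,1\}^n\to X$ put $$D_jf(x)=\tfrac12\big(f(x_1,\dots,x_j,\dots,x_n)-f(x_1,\dots,-x_j,\dots,x_n)\big),\qquad \Delta=\sum_{j=1}^nD_j,$$ let $e^{-t\Delta}$ be the heat semigroup, and let $$\|f\|_p=\big(\mathbb E\|f(x)\|^p\big)^{1/p},\qquad \|Df\|_p=\Big(\mathbb E\Big\|\sum_{j=1}^nx'_jD_jf(x)\Big\|^p\Big)^{1/p},$$ where $x,x'$ are independent and uniformly distributed on $\{-1,1\}^n$. **Theorem.** There is a universal constant $K>0$ such that for every $q\in[2,\infty)$, every Banach space $X$ of cotype $q$, every $p\in[1,2]$, every $n\ge 1$, every $f:\{-1,1\}^n\to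 X$ and every $t\ge0$, $$\|f-e^{-t\Delta}f\|_p\le K\,C_q(X)\,q^{3/2}\,(1-e^{-2t})^{1/q}\,\|Df\|_p .$$ -/

import Mathlib

open scoped BigOperators

namespace HammingCube

/-- The discrete cube `{-1,1}ⁿ`; `ℤˣ` is the two-element set `{1, -1}`. -/
abbrev Cube (n : ℕ) : Type := Fin n → ℤˣ

/-- Change the sign of the `j`-th coordinate. -/
def flip {n : ℕ} (j : Fin n) (x : Cube n) : Cube n := Function.update x j (-x j)

section Banach

variable {X : Type*} [NormedAddCommGroup X] [NormedSpace ℝ X]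

/-- The discrete partial derivative
`D_j f(x) = (f(x₁,…,x_j,…,x_n) - f(x₁,…,-x_j,…,x_n)) / 2`, as a bounded operator on the space of
`X`-valued functions on the cube (with the sup norm). -/
noncomputable def D {n : ℕ} (j : Fin n) : (Cube n → X) →L[ℝ] (Cube n → X) :=
  ContinuousLinearMap.pi fun x =>
    (1 / 2 : ℝ) • (ContinuousLinearMap.proj (R := ℝ) (φ := fun _ : Cube n => X) x
      - ContinuousLinearMap.proj (R := ℝ) (φ := fun _ : Cube n => X) (flip j x))

theorem D_apply {n : ℕ} (j : Fin n) (f : Cube n → X) (x : Cube n) :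
    D j f x = (1 / 2 : ℝ) • (f x - f (flip j x)) := rfl

/-- The cube Laplacian `Δ = ∑ⱼ D_j`. -/
noncomputable def laplacian (n : ℕ) (X : Type*) [NormedAddCommGroup X] [NormedSpace ℝ X] :
    (Cube n → X) →L[ℝ] (Cube n → X) :=
  ∑ j : Fin n, D j

/-- The heat semigroup `e^{-tΔ}`: the exponential of the bounded operator `-tΔ`. -/
noncomputable def heat (t : ℝ) {n : ℕ} : (Cube n → X) →L[ℝ] (Cube n → X) :=
  NormedSpace.exp ((-t) • laplacian n X)

/-- `‖f‖_p = (𝔼 ‖f(x)‖^p)^{1/p}`, for `x` uniform on the cube. -/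
noncomputable def cubeNorm (p : ℝ) {n : ℕ} (f : Cube n → X) : ℝ :=
  (Finset.univ.expect fun x : Cube n => ‖f x‖ ^ p) ^ (1 / p)

/-- `‖Df‖_p = (𝔼 ‖∑ⱼ x'_j D_j f(x)‖^p)^{1/p}`, for `x, x'` independent and uniform on the cube. -/
noncomputable def gradNorm (p : ℝ) {n : ℕ} (f : Cube n → X) : ℝ :=
  (Finset.univ.expect fun x : Cube n => Finset.univ.expect fun x' : Cube n =>
    ‖∑ j : Fin n, (((x' j : ℤ) : ℝ)) • D j f x‖ ^ p) ^ (1 / p)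

end Banach

/-- `C ≥ 0` is an admissible constant in the Rademacher cotype `q` inequality of `X`:
`∑ⱼ ‖x_j‖^q ≤ C^q 𝔼 ‖∑ⱼ ε_j x_j‖^q` for all finite sequences `x₁, …, x_m` in `X`, where
`ε` is uniform on `{-1,1}^m`. -/
def IsCotypeBound (X : Type*) [NormedAddCommGroup X] [NormedSpace ℝ X] (q C : ℝ) : Prop :=
  0 ≤ C ∧ ∀ (m : ℕ) (v : Fin m → X),
    ∑ j, ‖v j‖ ^ q ≤
      C ^ q * Finset.univ.expect fun ε : Cube m => ‖∑ j, (((ε j : ℤ) : ℝ)) • v j‖ ^ q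

/-- `X` has Rademacher cotype `q`. -/
def HasCotype (X : Type*) [NormedAddCommGroup X] [NormedSpace ℝ X] (q : ℝ) : Prop :=
  ∃ C : ℝ, IsCotypeBound X q C

/-- The cotype `q` constant `C_q(X)`: the best constant in the cotype `q` inequality
(meaningful when `X` has cotype `q`). -/
noncomputable def cotypeConst (X : Type*) [NormedAddCommGroup X] [NormedSpace ℝ X] (q : ℝ) : ℝ :=
  sInf {C : ℝ | IsCotypeBound X q C}

end HammingCube

/-! With `r = exp (-t)`, the heat semigroup is the noise operator `noise r`, the average of `f (ξ *
x)` over independent signs `ξ i` of mean `r`. So `f - heat t f` is the integral over `s` in `[r, 1]`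
of the derivative in `s`, which is `(1 - s ^ 2)⁻¹` times the mean of `∑ j, (ξ j - s) • D j f (ξ *
x)` (`noiseDeriv_eq`). By Jensen and invariance of the uniform law under `x ↦ ξ * x`, it suffices to
bound `∑ j, (ξ j - s) • v j` for fixed vectors `v j = D j f x`.

Cotype gains a factor `(1 - s ^ 2) ^ (1 / q)` there (`IsCotypeBound.biased_le`): in convex order,
the biased sum is dominated by one part of a Rademacher sum split at random into about `2 / (1 - s ^
2)` parts, and cotype bounds the parts jointly. Kahane–Khintchine with constant of order `√q` then
passes from the `q`-th moment of the Rademacher sum to its mean. The resulting bound `(1 - s) ^ (1 /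
q - 1)` has integral `q * (1 - r) ^ (1 / q)`, and `√q * q` is the stated power of `q`. -/

namespace HammingCube

/-! ### Means over finite product spaces -/

section ProductMean

variable {Ω Ω' : Type*} [Fintype Ω] [Fintype Ω']

/-- The mean of `F` under the `n`-fold product of the weight `μ`. -/
noncomputable def productMean (μ : Ω → ℝ) {n : ℕ} (F : (Fin n → Ω) → ℝ) : ℝ :=
  ∑ ω, (∏ i, μ (ω i)) * F ω

theorem productMean_zero (μ : Ω → ℝ) (F : (Fin 0 → Ω) → ℝ) :
    productMean μ F = F Fin.elim0 := by
  have : (default : Fin 0 → Ω) = Fin.elim0 := Subsingleton.elim _ _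
  simp [productMean, this]

theorem productMean_succ (μ : Ω → ℝ) {n : ℕ} (F : (Fin (n + 1) → Ω) → ℝ) :
    productMean μ F = ∑ o, μ o * productMean μ fun ω : Fin n → Ω => F (Fin.cons o ω) := by
  unfold productMean
  rw [← (Fin.consEquiv fun _ : Fin (n + 1) => Ω).sum_comp, Fintype.sum_prod_type]
  simp [Fin.consEquiv, Fin.prod_univ_succ, Finset.mul_sum, mul_assoc]

theorem productMean_mono {μ : Ω → ℝ} (hμ : ∀ o, 0 ≤ μ o) {n : ℕ} {F G : (Fin n → Ω) → ℝ}
    (h : ∀ ω, F ω ≤ G ω) : productMean μ F ≤ productMean μ G :=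
  Finset.sum_le_sum fun ω _ =>
    mul_le_mul_of_nonneg_left (h ω) (Finset.prod_nonneg fun _ _ => hμ _)

theorem productMean_nonneg {μ : Ω → ℝ} (hμ : ∀ o, 0 ≤ μ o) {n : ℕ} {F : (Fin n → Ω) → ℝ}
    (h : ∀ ω, 0 ≤ F ω) : 0 ≤ productMean μ F :=
  Finset.sum_nonneg fun ω _ => mul_nonneg (Finset.prod_nonneg fun _ _ => hμ _) (h ω)

theorem productMean_add (μ : Ω → ℝ) {n : ℕ} (F G : (Fin n → Ω) → ℝ) :
    productMean μ (fun ω => F ω + G ω) = productMean μ F + productMean μ G := by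
  simp [productMean, mul_add, Finset.sum_add_distrib]

theorem productMean_const_mul (μ : Ω → ℝ) {n : ℕ} (c : ℝ) (F : (Fin n → Ω) → ℝ) :
    productMean μ (fun ω => c * F ω) = c * productMean μ F := by
  simp [productMean, Finset.mul_sum, mul_left_comm]

theorem productMean_sum (μ : Ω → ℝ) {n : ℕ} {ι : Type*} (s : Finset ι)
    (F : ι → (Fin n → Ω) → ℝ) :
    productMean μ (fun ω => ∑ k ∈ s, F k ω) = ∑ k ∈ s, productMean μ (F k) := by
  simp only [productMean, Finset.mul_sum]
  exact Finset.sum_comm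

theorem sum_prod_weight {μ : Ω → ℝ} (hμ : ∑ o, μ o = 1) (n : ℕ) :
    ∑ ω : Fin n → Ω, ∏ i, μ (ω i) = 1 := by
  rw [← Fintype.sum_pow, hμ, one_pow]

theorem productMean_const {μ : Ω → ℝ} (hμ : ∑ o, μ o = 1) {n : ℕ} (c : ℝ) :
    productMean μ (fun _ : Fin n → Ω => c) = c := by
  rw [productMean, ← Finset.sum_mul, sum_prod_weight hμ, one_mul]

/-- Monotonicity of power means, in the form of a bound. -/
theorem productMean_rpow_le {μ : Ω → ℝ} (hμ : ∀ o, 0 ≤ μ o) (h1 : ∑ o, μ o = 1) {n : ℕ}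
    {g : (Fin n → Ω) → ℝ} (hg : ∀ ω, 0 ≤ g ω) {p q M : ℝ} (hp : 0 < p) (hpq : p ≤ q)
    (hM : 0 ≤ M) (h : productMean μ (fun ω => g ω ^ q) ≤ M ^ q) :
    productMean μ (fun ω => g ω ^ p) ≤ M ^ p := by
  have hq : 0 < q := hp.trans_le hpq
  have key := Real.rpow_arith_mean_le_arith_mean_rpow Finset.univ
    (fun ω : Fin n → Ω => ∏ i, μ (ω i)) (fun ω => g ω ^ p)
    (fun ω _ => Finset.prod_nonneg fun _ _ => hμ _) (sum_prod_weight h1 n)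
    (fun ω _ => Real.rpow_nonneg (hg ω) _) ((one_le_div hp).2 hpq)
  have e : ∀ a : ℝ, 0 ≤ a → (a ^ p) ^ (q / p) = a ^ q := fun a ha => by
    rw [← Real.rpow_mul ha, mul_div_cancel₀ _ hp.ne']
  simp only [e _ (hg _)] at key
  have h0 : 0 ≤ productMean μ (fun ω => g ω ^ p) :=
    productMean_nonneg hμ fun ω => Real.rpow_nonneg (hg ω) _
  refine (Real.rpow_le_rpow_iff h0 (Real.rpow_nonneg hM _) (div_pos hq hp)).1 ?_
  rw [e _ hM]
  exact key.trans h

/-- Minkowski's inequality for two functions, in the form of a bound. -/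
theorem productMean_half_add_pow_le {μ : Ω → ℝ} (hμ : ∀ o, 0 ≤ μ o) {n k : ℕ}
    {g h : (Fin n → Ω) → ℝ} (hg : ∀ ω, 0 ≤ g ω) (hh : ∀ ω, 0 ≤ h ω) {P Q : ℝ}
    (hP : 0 ≤ P) (hQ : 0 ≤ Q) (h1 : productMean μ (fun ω => g ω ^ k) ≤ P ^ k)
    (h2 : productMean μ (fun ω => h ω ^ k) ≤ Q ^ k) :
    productMean μ (fun ω => ((g ω + h ω) / 2) ^ k) ≤ ((P + Q) / 2) ^ k := by
  have main : ∀ P Q : ℝ, 0 < P → 0 < Q → productMean μ (fun ω => g ω ^ k) ≤ P ^ k →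
      productMean μ (fun ω => h ω ^ k) ≤ Q ^ k →
      productMean μ (fun ω => ((g ω + h ω) / 2) ^ k) ≤ ((P + Q) / 2) ^ k := by
    intro P Q hP hQ h1 h2
    have hs : 0 < P + Q := by positivity
    -- Convexity of the `k`-th power at `g / P` and `h / Q`, with weights proportional to `P` and
    -- `Q`.
    have pt : ∀ ω, ((g ω + h ω) / 2) ^ k ≤
        ((P + Q) / 2) ^ k * (P / (P + Q) / P ^ k * g ω ^ k + Q / (P + Q) / Q ^ k * h ω ^ k) := by
      intro ω
      have := (convexOn_pow (𝕜 := ℝ) k).2 (Set.mem_Ici.2 (div_nonneg (hg ω) hP.le))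
        (Set.mem_Ici.2 (div_nonneg (hh ω) hQ.le)) (div_nonneg hP.le hs.le)
        (div_nonneg hQ.le hs.le) (by field_simp)
      simp only [smul_eq_mul] at this
      have e : (g ω + h ω) / 2 =
          (P + Q) / 2 * (P / (P + Q) * (g ω / P) + Q / (P + Q) * (h ω / Q)) := by
        field_simp
      rw [e, mul_pow]
      refine mul_le_mul_of_nonneg_left (this.trans (le_of_eq ?_)) (by positivity)
      rw [div_pow, div_pow]; ring
    refine (productMean_mono hμ pt).trans ?_
    rw [productMean_const_mul, productMean_add, productMean_const_mul, productMean_const_mul]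
    refine mul_le_of_le_one_right (by positivity) ?_
    have a1 := mul_le_mul_of_nonneg_left h1 (show 0 ≤ P / (P + Q) / P ^ k by positivity)
    have a2 := mul_le_mul_of_nonneg_left h2 (show 0 ≤ Q / (P + Q) / Q ^ k by positivity)
    refine (add_le_add a1 a2).trans (le_of_eq ?_)
    field_simp
  -- Vanishing `P` or `Q` is handled by enlarging both by `η` and letting `η` tend to zero.
  have ht : Filter.Tendsto (fun η : ℝ => (((P + η) + (Q + η)) / 2) ^ k) (nhdsWithin 0 (Set.Ioi 0))
      (nhds (((P + Q) / 2) ^ k)) := by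
    have : Continuous fun η : ℝ => (((P + η) + (Q + η)) / 2) ^ k := by fun_prop
    simpa using (this.tendsto 0).mono_left nhdsWithin_le_nhds
  refine ge_of_tendsto ht ?_
  filter_upwards [self_mem_nhdsWithin] with η hη
  have hη : 0 < η := hη
  exact main _ _ (by positivity) (by positivity)
    (h1.trans (pow_le_pow_left₀ hP (by linarith) _))
    (h2.trans (pow_le_pow_left₀ hQ (by linarith) _))

variable {X : Type*} [NormedAddCommGroup X] [NormedSpace ℝ X]

theorem convexOn_productMean {μ : Ω → ℝ} (hμ : ∀ o, 0 ≤ μ o) {n : ℕ} {φ : X → ℝ}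
    (hφ : ConvexOn ℝ Set.univ φ) (s : (Fin n → Ω) → X) :
    ConvexOn ℝ Set.univ fun a => productMean μ fun ω => φ (a + s ω) := by
  refine ⟨convex_univ, fun a _ b _ t u ht hu htu => ?_⟩
  simp only [smul_eq_mul]
  rw [← productMean_const_mul, ← productMean_const_mul, ← productMean_add]
  refine productMean_mono hμ fun ω => ?_
  have := hφ.2 (Set.mem_univ (a + s ω)) (Set.mem_univ (b + s ω)) ht hu htu
  have e : t • (a + s ω) + u • (b + s ω) = t • a + u • b + (t + u) • s ω := by module
  rwa [e, htu, one_smul] at this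

/-- A comparison of means of convex functions in one coordinate tensorizes. -/
theorem productMean_le_of_convex {μ : Ω → ℝ} {ν : Ω' → ℝ} (hμ : ∀ o, 0 ≤ μ o)
    (hν : ∀ o, 0 ≤ ν o) {c : Ω → ℝ} {d : Ω' → ℝ}
    (h : ∀ φ : X → ℝ, ConvexOn ℝ Set.univ φ → ∀ a v,
      ∑ o, μ o * φ (a + c o • v) ≤ ∑ o, ν o * φ (a + d o • v))
    {φ : X → ℝ} (hφ : ConvexOn ℝ Set.univ φ) {n : ℕ} (v : Fin n → X) (a : X) :
    productMean μ (fun ω => φ (a + ∑ i, c (ω i) • v i)) ≤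
      productMean ν (fun ω => φ (a + ∑ i, d (ω i) • v i)) := by
  induction n generalizing a with
  | zero => simp [productMean_zero]
  | succ n ih =>
    rw [productMean_succ, productMean_succ]
    simp only [Fin.sum_univ_succ, Fin.cons_zero, Fin.cons_succ, ← add_assoc]
    -- Once the other coordinates are replaced, their mean under `ν` is again convex in the base
    -- point, so the one-coordinate hypothesis applies to it.
    refine (Finset.sum_le_sum fun o _ =>
      mul_le_mul_of_nonneg_left (ih (fun i => v i.succ) _) (hμ o)).trans ?_
    exact h _ (convexOn_productMean hν hφ _) a (v 0)

end ProductMean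

/-! ### Hypercontractivity and the Kahane–Khintchine inequality -/

theorem sum_range_two_mul_add_one (g : ℕ → ℝ) (k : ℕ) :
    ∑ m ∈ Finset.range (2 * k + 1), g m =
      ∑ j ∈ Finset.range (k + 1), g (2 * j) + ∑ j ∈ Finset.range k, g (2 * j + 1) := by
  induction k with
  | zero => simp
  | succ k ih =>
    rw [show 2 * (k + 1) + 1 = (2 * k + 1) + 1 + 1 by ring, Finset.sum_range_succ,
      Finset.sum_range_succ, ih, Finset.sum_range_succ _ (k + 1),
      Finset.sum_range_succ (fun j => g (2 * j + 1)) k, show 2 * (k + 1) = 2 * k + 1 + 1 by ring]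
    ring

/-- From `j` to `j + 1` the left side grows by `(k - j) * (2 * k - 2 * j - 1) / ((j + 1) * (2 * j +
1))`, the right side by `(2 * k - 1) * (k - j) / (j + 1)`. -/
theorem choose_two_mul_le (k j : ℕ) (hk : 1 ≤ k) :
    ((2 * k).choose (2 * j) : ℝ) ≤ (2 * k - 1) ^ j * k.choose j := by
  have hk' : (1 : ℝ) ≤ k := by exact_mod_cast hk
  induction j with
  | zero => simp
  | succ j ih =>
    rcases Nat.lt_or_ge j k with hj | hj
    · have e1 := Nat.choose_succ_right_eq (2 * k) (2 * j)
      have e2 := Nat.choose_succ_right_eq (2 * k) (2 * j + 1)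
      have e3 := Nat.choose_succ_right_eq k j
      obtain ⟨d, rfl⟩ := Nat.exists_eq_add_of_lt hj
      rw [show 2 * (j + d + 1) - 2 * j = 2 * d + 2 by omega] at e1
      rw [show 2 * (j + d + 1) - (2 * j + 1) = 2 * d + 1 by omega] at e2
      rw [show j + d + 1 - j = d + 1 by omega] at e3
      rw [show 2 * (j + 1) = 2 * j + 1 + 1 by ring]
      generalize (2 * (j + d + 1)).choose (2 * j + 1 + 1) = c2 at *
      generalize (2 * (j + d + 1)).choose (2 * j + 1) = c1 at *
      generalize (2 * (j + d + 1)).choose (2 * j) = c0 at *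
      generalize (j + d + 1).choose (j + 1) = b1 at *
      generalize (j + d + 1).choose j = b0 at *
      have e1 : (c1 : ℝ) * (2 * j + 1) = c0 * (2 * d + 2) := by exact_mod_cast e1
      have e2 : (c2 : ℝ) * (2 * j + 1 + 1) = c1 * (2 * d + 1) := by exact_mod_cast e2
      have e3 : (b1 : ℝ) * (j + 1) = b0 * (d + 1) := by exact_mod_cast e3
      push_cast at ih ⊢
      set K : ℝ := 2 * (j + d + 1) - 1 with hK
      have hK0 : 0 ≤ K := by
        simp only [hK]
        linarith [(Nat.cast_nonneg j : (0 : ℝ) ≤ j), (Nat.cast_nonneg d : (0 : ℝ) ≤ d)]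
      have f1 : (c2 : ℝ) * (2 * j + 1) * (j + 1) = c0 * (d + 1) * (2 * d + 1) := by
        linear_combination (2 * j + 1) / 2 * e2 + (2 * d + 1) / 2 * e1
      have f2 : (c0 : ℝ) * (d + 1) * (2 * d + 1) ≤ (K ^ j * b0) * (d + 1) * K := by
        gcongr
        simp only [hK]; linarith [(Nat.cast_nonneg j : (0 : ℝ) ≤ j)]
      have f3 : (c2 : ℝ) * (j + 1) ≤ c2 * (2 * j + 1) * (j + 1) := by
        have : (0 : ℝ) ≤ c2 * (j + 1) * (2 * j) := by positivity
        linarith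
      have f4 : K ^ j * b0 * (d + 1) * K = K ^ (j + 1) * b1 * (j + 1) := by
        linear_combination -(K ^ (j + 1)) * e3
      have hj1 : (0 : ℝ) < j + 1 := by positivity
      exact le_of_mul_le_mul_right (by linarith) hj1
    · rw [Nat.choose_eq_zero_of_lt (by omega)]
      have : (0 : ℝ) ≤ 2 * k - 1 := by linarith
      simp only [Nat.cast_zero]
      positivity

/-- Only even powers of `B` survive the average; the two expansions then compare term by term, `ρ ^
(2 * j)` cancelling the factor `(2 * k - 1) ^ j` of `choose_two_mul_le`. -/
theorem two_point_scalar {k : ℕ} (hk : 1 ≤ k) {ρ : ℝ} (hρ : ρ ^ 2 * (2 * k - 1) = 1) (A B : ℝ) :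
    ((A + ρ * B) ^ (2 * k) + (A - ρ * B) ^ (2 * k)) / 2 ≤ (A ^ 2 + B ^ 2) ^ k := by
  have e1 : ((A + ρ * B) ^ (2 * k) + (A - ρ * B) ^ (2 * k)) / 2 =
      ∑ j ∈ Finset.range (k + 1),
        (ρ ^ 2 * B ^ 2) ^ j * (A ^ 2) ^ (k - j) * (2 * k).choose (2 * j) := by
    rw [add_comm A, show A - ρ * B = -(ρ * B) + A by ring, add_pow, add_pow,
      ← Finset.sum_add_distrib, sum_range_two_mul_add_one, add_div]
    rw [Finset.sum_eq_zero (s := Finset.range k), zero_div, add_zero, Finset.sum_div]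
    · refine Finset.sum_congr rfl fun j hj => ?_
      rw [Even.neg_pow ⟨j, by ring⟩, show 2 * k - 2 * j = 2 * (k - j) by omega, pow_mul, pow_mul,
        mul_pow ρ B]
      ring
    · intro j _
      rw [Odd.neg_pow ⟨j, rfl⟩]
      ring
  rw [e1, add_comm (A ^ 2), add_pow]
  refine Finset.sum_le_sum fun j _ => ?_
  have h := choose_two_mul_le k j hk
  have e2 : (ρ ^ 2) ^ j * (2 * k - 1) ^ j = 1 := by rw [← mul_pow, hρ, one_pow]
  calc (ρ ^ 2 * B ^ 2) ^ j * (A ^ 2) ^ (k - j) * (2 * k).choose (2 * j)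
      ≤ (ρ ^ 2 * B ^ 2) ^ j * (A ^ 2) ^ (k - j) * ((2 * k - 1) ^ j * k.choose j) :=
        mul_le_mul_of_nonneg_left h (by positivity)
    _ = (B ^ 2) ^ j * (A ^ 2) ^ (k - j) * k.choose j := by
        rw [mul_pow]
        linear_combination (B ^ 2) ^ j * (A ^ 2) ^ (k - j) * k.choose j * e2

variable {X : Type*} [NormedAddCommGroup X] [NormedSpace ℝ X]

/-- The points `a ± ρ • x` are convex combinations of `a ± x`, so their norms are at most `A ± ρ *
B` with `A` and `B` the half sum and half difference of `u` and `v`. This reduces to the scalar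
case, as `A ^ 2 + B ^ 2 = (u ^ 2 + v ^ 2) / 2`. -/
theorem two_point_norm {k : ℕ} (hk : 1 ≤ k) {ρ : ℝ} (h0 : 0 ≤ ρ) (h1 : ρ ≤ 1)
    (hρ : ρ ^ 2 * (2 * k - 1) = 1) (a x : X) :
    (‖a + ρ • x‖ ^ (2 * k) + ‖a - ρ • x‖ ^ (2 * k)) / 2 ≤
      ((‖a + x‖ ^ 2 + ‖a - x‖ ^ 2) / 2) ^ k := by
  set u := ‖a + x‖
  set v := ‖a - x‖
  have b1 : ‖a + ρ • x‖ ≤ (u + v) / 2 + ρ * ((u - v) / 2) := by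
    have e : a + ρ • x = ((1 + ρ) / 2) • (a + x) + ((1 - ρ) / 2) • (a - x) := by module
    rw [e]
    refine (norm_add_le _ _).trans (le_of_eq ?_)
    rw [norm_smul, norm_smul, Real.norm_of_nonneg (by linarith), Real.norm_of_nonneg (by linarith)]
    ring
  have b2 : ‖a - ρ • x‖ ≤ (u + v) / 2 - ρ * ((u - v) / 2) := by
    have e : a - ρ • x = ((1 - ρ) / 2) • (a + x) + ((1 + ρ) / 2) • (a - x) := by module
    rw [e]
    refine (norm_add_le _ _).trans (le_of_eq ?_)
    rw [norm_smul, norm_smul, Real.norm_of_nonneg (by linarith), Real.norm_of_nonneg (by linarith)]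
    ring
  have := two_point_scalar hk hρ ((u + v) / 2) ((u - v) / 2)
  calc _ ≤ (((u + v) / 2 + ρ * ((u - v) / 2)) ^ (2 * k) +
        ((u + v) / 2 - ρ * ((u - v) / 2)) ^ (2 * k)) / 2 := by gcongr
    _ ≤ _ := this
    _ = _ := by congr 1; ring

/-- The mean over uniform signs. -/
noncomputable abbrev signMean {n : ℕ} (F : Cube n → ℝ) : ℝ := productMean (fun _ : ℤˣ => 1 / 2) F

theorem expect_eq_signMean {n : ℕ} (F : Cube n → ℝ) : Finset.univ.expect F = signMean F := by
  rw [Finset.expect_eq_sum_div_card, signMean, productMean, Finset.sum_div]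
  refine Finset.sum_congr rfl fun ω _ => ?_
  simp [div_eq_inv_mul]

theorem half_nonneg (_ : ℤˣ) : (0 : ℝ) ≤ 1 / 2 := by norm_num

theorem sum_half : ∑ _ : ℤˣ, (1 / 2 : ℝ) = 1 := by simp

theorem sum_units_int {M : Type*} [AddCommMonoid M] (g : ℤˣ → M) : ∑ u, g u = g 1 + g (-1) := by
  rw [show (Finset.univ : Finset ℤˣ) = {1, -1} from rfl, Finset.sum_pair (by decide)]

theorem signMean_succ {n : ℕ} (F : Cube (n + 1) → ℝ) :
    signMean F = signMean fun ε : Cube n => (F (Fin.cons 1 ε) + F (Fin.cons (-1) ε)) / 2 := by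
  rw [signMean, productMean_succ, sum_units_int, ← productMean_const_mul, ← productMean_const_mul,
    ← productMean_add]
  congr 1
  ext ε
  ring

/-- Hypercontractivity for Rademacher sums with an even exponent. -/
theorem signMean_norm_pow_le {k : ℕ} (hk : 1 ≤ k) {ρ : ℝ} (h0 : 0 ≤ ρ) (h1 : ρ ≤ 1)
    (hρ : ρ ^ 2 * (2 * k - 1) = 1) {n : ℕ} (v : Fin n → X) (a : X) :
    signMean (fun ε : Cube n => ‖a + ρ • ∑ i, ((ε i : ℤ) : ℝ) • v i‖ ^ (2 * k)) ≤
      (signMean fun ε : Cube n => ‖a + ∑ i, ((ε i : ℤ) : ℝ) • v i‖ ^ 2) ^ k := by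
  induction n generalizing a with
  | zero => simp [signMean, productMean_zero, pow_mul]
  | succ n ih =>
    rw [signMean_succ, signMean_succ]
    simp only [Fin.sum_univ_succ, Fin.cons_zero, Fin.cons_succ, Units.val_one, Int.cast_one,
      Units.val_neg, Int.cast_neg, one_smul, neg_smul]
    set S : Cube n → X := fun ε => ∑ i, ((ε i : ℤ) : ℝ) • v i.succ with hS
    -- The two-point inequality in the first sign, the others being frozen in the base point `a + ρ
    -- • S ε`.
    have key : ∀ ε, (‖a + ρ • (v 0 + S ε)‖ ^ (2 * k) + ‖a + ρ • (-v 0 + S ε)‖ ^ (2 * k)) / 2 ≤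
        ((‖a + v 0 + ρ • S ε‖ ^ 2 + ‖a - v 0 + ρ • S ε‖ ^ 2) / 2) ^ k := fun ε => by
      have := two_point_norm hk h0 h1 hρ (a + ρ • S ε) (v 0)
      rwa [show a + ρ • S ε + ρ • v 0 = a + ρ • (v 0 + S ε) by module,
        show a + ρ • S ε - ρ • v 0 = a + ρ • (-v 0 + S ε) by module,
        show a + ρ • S ε + v 0 = a + v 0 + ρ • S ε by module,
        show a + ρ • S ε - v 0 = a - v 0 + ρ • S ε by module] at this
    refine (productMean_mono half_nonneg key).trans ?_
    have i1 := ih (fun i => v i.succ) (a + v 0)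
    have i2 := ih (fun i => v i.succ) (a - v 0)
    simp only [pow_mul] at i1 i2
    -- Minkowski in `L^k` for the squared norms separates the two values of the first sign, so that
    -- induction bounds each.
    refine (productMean_half_add_pow_le half_nonneg (fun _ => by positivity)
      (fun _ => by positivity) (productMean_nonneg half_nonneg fun _ => by positivity)
      (productMean_nonneg half_nonneg fun _ => by positivity) i1 i2).trans (le_of_eq ?_)
    congr 1
    rw [← productMean_add, div_eq_inv_mul, ← productMean_const_mul]
    congr 1
    ext ε
    rw [div_eq_inv_mul, sub_eq_add_neg, add_assoc, add_assoc]

theorem signMean_pow_le_sq {k : ℕ} (hk : 1 ≤ k) {n : ℕ} (v : Fin n → X) :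
    signMean (fun ε : Cube n => ‖∑ i, ((ε i : ℤ) : ℝ) • v i‖ ^ (2 * k)) ≤
      (2 * k - 1) ^ k * (signMean fun ε : Cube n => ‖∑ i, ((ε i : ℤ) : ℝ) • v i‖ ^ 2) ^ k := by
  have hk' : (1 : ℝ) ≤ k := by exact_mod_cast hk
  have hK : (1 : ℝ) ≤ 2 * k - 1 := by linarith
  have hK0 : (0 : ℝ) < 2 * k - 1 := by linarith
  have hs : (Real.sqrt (2 * k - 1))⁻¹ ^ 2 * (2 * k - 1) = 1 := by
    rw [inv_pow, Real.sq_sqrt hK0.le, inv_mul_cancel₀ hK0.ne']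
  have h := signMean_norm_pow_le hk (inv_nonneg.2 (Real.sqrt_nonneg _))
    (inv_le_one_of_one_le₀ (Real.one_le_sqrt.2 hK)) hs v 0
  simp only [zero_add, norm_smul, mul_pow, signMean, productMean_const_mul] at h
  rw [Real.norm_of_nonneg (by positivity), pow_mul] at h
  have e : (2 * k - 1 : ℝ) ^ k * ((Real.sqrt (2 * k - 1))⁻¹ ^ 2) ^ k = 1 := by
    rw [← mul_pow, mul_comm, hs, one_pow]
  have := mul_le_mul_of_nonneg_left h (pow_nonneg hK0.le k)
  rwa [← mul_assoc, e, one_mul] at this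

/-- Write `m i` for the `i`-th moment. Cauchy–Schwarz gives `m2 ^ 2 ≤ m1 * m3` and `m3 ^ 2 ≤ m2 *
m4`, while hypercontractivity at `k = 2` gives `m4 ≤ 9 * m2 ^ 2`; eliminate `m3` and `m4`. -/
theorem signMean_sq_le {n : ℕ} (v : Fin n → X) :
    signMean (fun ε : Cube n => ‖∑ i, ((ε i : ℤ) : ℝ) • v i‖ ^ 2) ≤
      9 * (signMean fun ε : Cube n => ‖∑ i, ((ε i : ℤ) : ℝ) • v i‖) ^ 2 := by
  have h4 := signMean_pow_le_sq (k := 2) (by norm_num) v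
  norm_num at h4
  set S : Cube n → ℝ := fun ε => ‖∑ i, ((ε i : ℤ) : ℝ) • v i‖ with hS
  have hS0 : ∀ ε, 0 ≤ S ε := fun ε => norm_nonneg _
  change signMean (fun ε => S ε ^ 4) ≤ 9 * signMean (fun ε => S ε ^ 2) ^ 2 at h4
  change signMean (fun ε => S ε ^ 2) ≤ 9 * signMean S ^ 2
  have cs : ∀ F G H : Cube n → ℝ, (∀ ε, 0 ≤ F ε) → (∀ ε, 0 ≤ G ε) →
      (∀ ε, H ε ^ 2 = F ε * G ε) → signMean H ^ 2 ≤ signMean F * signMean G := by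
    intro F G H hF hG hH
    have w : ∀ ε : Cube n, 0 ≤ ∏ _i : Fin n, (1 / 2 : ℝ) := fun ε => by positivity
    refine Finset.sum_sq_le_sum_mul_sum_of_sq_le_mul _ (fun ε _ => mul_nonneg (w ε) (hF ε))
      (fun ε _ => mul_nonneg (w ε) (hG ε)) fun ε _ => ?_
    rw [mul_pow, hH]; exact le_of_eq (by ring)
  have c1 := cs S (fun ε => S ε ^ 3) (fun ε => S ε ^ 2) hS0 (fun ε => pow_nonneg (hS0 ε) _)
    fun ε => by ring
  have c2 := cs (fun ε => S ε ^ 2) (fun ε => S ε ^ 4) (fun ε => S ε ^ 3)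
    (fun ε => pow_nonneg (hS0 ε) _) (fun ε => pow_nonneg (hS0 ε) _) fun ε => by ring
  have p1 : 0 ≤ signMean S := productMean_nonneg half_nonneg hS0
  have p2 : 0 ≤ signMean fun ε => S ε ^ 2 :=
    productMean_nonneg half_nonneg fun ε => pow_nonneg (hS0 ε) _
  have p3 : 0 ≤ signMean fun ε => S ε ^ 3 :=
    productMean_nonneg half_nonneg fun ε => pow_nonneg (hS0 ε) _
  generalize (signMean fun ε => S ε ^ 4) = m4 at *
  generalize (signMean fun ε => S ε ^ 3) = m3 at *
  generalize (signMean fun ε => S ε ^ 2) = m2 at *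
  generalize signMean S = m1 at *
  rcases p2.eq_or_lt with h | h
  · rw [← h]; positivity
  have c3 : m3 ^ 2 ≤ 9 * m2 ^ 3 := c2.trans (by nlinarith)
  have c4 : (m2 ^ 2) ^ 2 ≤ (m1 * m3) ^ 2 := pow_le_pow_left₀ (by positivity) c1 2
  have c5 : m2 * m2 ^ 3 ≤ 9 * m1 ^ 2 * m2 ^ 3 := by
    nlinarith [mul_le_mul_of_nonneg_left c3 (sq_nonneg m1)]
  exact le_of_mul_le_mul_right c5 (by positivity)

/-- The Kahane–Khintchine inequality with a constant of order `√q`. -/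
theorem kahane_khintchine {q : ℝ} (hq : 2 ≤ q) {n : ℕ} (v : Fin n → X) :
    signMean (fun ε : Cube n => ‖∑ i, ((ε i : ℤ) : ℝ) • v i‖ ^ q) ≤
      (3 * Real.sqrt (2 * q) * signMean fun ε : Cube n => ‖∑ i, ((ε i : ℤ) : ℝ) • v i‖) ^ q := by
  set m := signMean fun ε : Cube n => ‖∑ i, ((ε i : ℤ) : ℝ) • v i‖ with hm
  have m0 : 0 ≤ m := productMean_nonneg half_nonneg fun ε => norm_nonneg _
  -- The even exponent `2 * k` with `k = ⌈q / 2⌉₊` is at least `q`, and `2 * k - 1 < q + 1 ≤ 2 * q`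
  -- gives the factor `√(2 * q)`.
  have hceil : (⌈q / 2⌉₊ : ℝ) < q / 2 + 1 := Nat.ceil_lt_add_one (by linarith)
  have hceil' : q / 2 ≤ (⌈q / 2⌉₊ : ℝ) := Nat.le_ceil _
  generalize ⌈q / 2⌉₊ = k at *
  have hk : 1 ≤ k := by
    have : (1 : ℝ) ≤ k := by linarith
    exact_mod_cast this
  have hk' : (1 : ℝ) ≤ k := by exact_mod_cast hk
  have hK0 : (0 : ℝ) ≤ 2 * k - 1 := by linarith
  refine productMean_rpow_le half_nonneg sum_half (fun ε => norm_nonneg _) (by linarith)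
    (show q ≤ ((2 * k : ℕ) : ℝ) by push_cast; linarith) (by positivity) ?_
  simp only [Real.rpow_natCast]
  refine (signMean_pow_le_sq hk v).trans ?_
  rw [← mul_pow, pow_mul]
  refine pow_le_pow_left₀ (mul_nonneg hK0 (productMean_nonneg half_nonneg fun _ => by positivity))
    ?_ k
  have h1 := mul_le_mul_of_nonneg_left (signMean_sq_le v) hK0
  rw [← hm] at h1
  refine h1.trans ?_
  rw [mul_pow, mul_pow, Real.sq_sqrt (by linarith)]
  nlinarith [sq_nonneg m]

/-! ### Biased signs and random splitting under cotype -/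

theorem productMean_comm {Ω Ω' : Type*} [Fintype Ω] [Fintype Ω'] (μ : Ω → ℝ) (ν : Ω' → ℝ)
    {n m : ℕ} (F : (Fin n → Ω) → (Fin m → Ω') → ℝ) :
    productMean μ (fun ω => productMean ν fun ω' => F ω ω') =
      productMean ν (fun ω' => productMean μ fun ω => F ω ω') := by
  simp only [productMean, Finset.mul_sum]
  rw [Finset.sum_comm]
  simp only [mul_left_comm]

/-- The weight on `{-1, 1}` with mean `r`. -/
noncomputable def biasedWeight (r : ℝ) (u : ℤˣ) : ℝ := (1 + r * ((u : ℤ) : ℝ)) / 2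

theorem biasedWeight_one (r : ℝ) : biasedWeight r 1 = (1 + r) / 2 := by simp [biasedWeight]

theorem biasedWeight_neg_one (r : ℝ) : biasedWeight r (-1) = (1 - r) / 2 := by
  simp [biasedWeight, sub_eq_add_neg]

theorem biasedWeight_nonneg {r : ℝ} (h0 : 0 ≤ r) (h1 : r ≤ 1) (u : ℤˣ) : 0 ≤ biasedWeight r u := by
  rcases Int.units_eq_one_or u with rfl | rfl
  · rw [biasedWeight_one]; linarith
  · rw [biasedWeight_neg_one]; linarith

theorem sum_biasedWeight (r : ℝ) : ∑ u, biasedWeight r u = 1 := by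
  rw [sum_units_int, biasedWeight_one, biasedWeight_neg_one]; ring

theorem convexOn_norm_rpow {q : ℝ} (hq : 1 ≤ q) :
    ConvexOn ℝ Set.univ fun x : X => ‖x‖ ^ q := by
  refine ⟨convex_univ, fun x _ y _ t u ht hu htu => ?_⟩
  have h := (convexOn_norm (E := X) convex_univ).2 (Set.mem_univ x) (Set.mem_univ y) ht hu htu
  exact (Real.rpow_le_rpow (norm_nonneg _) h (by linarith)).trans
    ((convexOn_rpow hq).2 (Set.mem_Ici.2 (norm_nonneg x)) (Set.mem_Ici.2 (norm_nonneg y)) ht hu htu)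

/-- Write `1 - r` as a mean of `2` and `0`, and `-1 - r` as a mean of `-2` and `0`. The biased law
then spreads to mass `(1 - r ^ 2) / 4` at each of `±2` and the rest at `0`. The right side has mass
`1 / (2 * N)` at each of `±2`, which is at least as much. -/
theorem biased_le_selected {r : ℝ} (h0 : 0 ≤ r) (h1 : r ≤ 1) {N : ℕ} (hN : 0 < N)
    (hr : (1 - r ^ 2) / 2 ≤ 1 / N) (k : Fin N) {φ : X → ℝ} (hφ : ConvexOn ℝ Set.univ φ) (a v : X) :
    ∑ u, biasedWeight r u * φ (a + (((u : ℤ) : ℝ) - r) • v) ≤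
      ∑ o : ℤˣ × Fin N, 1 / (2 * N : ℝ) *
        φ (a + (if o.2 = k then 2 * ((o.1 : ℤ) : ℝ) else 0) • v) := by
  have hN' : (N : ℝ) ≠ 0 := by positivity
  have e : ∑ o : ℤˣ × Fin N, 1 / (2 * N : ℝ) *
        φ (a + (if o.2 = k then 2 * ((o.1 : ℤ) : ℝ) else 0) • v) =
      φ a + 1 / N * ((φ (a + (2 : ℝ) • v) + φ (a - (2 : ℝ) • v)) / 2 - φ a) := by
    have term : ∀ l : Fin N, ∑ u : ℤˣ, 1 / (2 * N : ℝ) *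
        φ (a + (if l = k then 2 * ((u : ℤ) : ℝ) else 0) • v) = φ a / N +
          if l = k then 1 / N * ((φ (a + (2 : ℝ) • v) + φ (a - (2 : ℝ) • v)) / 2 - φ a) else 0 := by
      intro l
      rw [sum_units_int]
      split_ifs
      · simp only [Units.val_one, Int.cast_one, Units.val_neg, Int.cast_neg, mul_one, mul_neg,
          neg_smul, ← sub_eq_add_neg]
        field_simp
        ring
      · simp only [zero_smul, add_zero]
        field_simp
        ring
    rw [Fintype.sum_prod_type_right, Finset.sum_congr rfl fun l _ => term l,
      Finset.sum_add_distrib, Finset.sum_ite_eq', if_pos (Finset.mem_univ k), Finset.sum_const,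
      Finset.card_univ, Fintype.card_fin, nsmul_eq_mul, mul_div_cancel₀ _ hN']
  rw [e, sum_units_int, biasedWeight_one, biasedWeight_neg_one]
  have c1 := hφ.2 (Set.mem_univ (a + (2 : ℝ) • v)) (Set.mem_univ a)
    (show 0 ≤ (1 - r) / 2 by linarith) (show 0 ≤ (1 + r) / 2 by linarith) (by ring)
  have c2 := hφ.2 (Set.mem_univ (a - (2 : ℝ) • v)) (Set.mem_univ a)
    (show 0 ≤ (1 + r) / 2 by linarith) (show 0 ≤ (1 - r) / 2 by linarith) (by ring)
  have c3 := hφ.2 (Set.mem_univ (a + (2 : ℝ) • v)) (Set.mem_univ (a - (2 : ℝ) • v))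
    (show (0 : ℝ) ≤ 1 / 2 by norm_num) (show (0 : ℝ) ≤ 1 / 2 by norm_num) (by norm_num)
  rw [show (1 / 2 : ℝ) • (a + (2 : ℝ) • v) + (1 / 2 : ℝ) • (a - (2 : ℝ) • v) = a by module] at c3
  rw [show ((1 - r) / 2) • (a + (2 : ℝ) • v) + ((1 + r) / 2) • a = a + (1 - r) • v by module] at c1
  rw [show ((1 + r) / 2) • (a - (2 : ℝ) • v) + ((1 - r) / 2) • a = a + (-1 - r) • v by module] at c2
  simp only [smul_eq_mul] at c1 c2 c3
  simp only [Units.val_one, Int.cast_one, Units.val_neg, Int.cast_neg]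
  have d1 := mul_le_mul_of_nonneg_left c1 (show 0 ≤ (1 + r) / 2 by linarith)
  have d2 := mul_le_mul_of_nonneg_left c2 (show 0 ≤ (1 - r) / 2 by linarith)
  have d3 := mul_le_mul_of_nonneg_right hr
    (show 0 ≤ (φ (a + (2 : ℝ) • v) + φ (a - (2 : ℝ) • v)) / 2 - φ a by linarith)
  nlinarith

/-- Splitting a Rademacher sum at random into `N` parts and applying the cotype inequality. -/
theorem IsCotypeBound.mul_biased_le {q C : ℝ} (hq : 1 ≤ q) (hC : IsCotypeBound X q C) {r : ℝ}
    (h0 : 0 ≤ r) (h1 : r ≤ 1) {N : ℕ} (hN : 0 < N) (hr : (1 - r ^ 2) / 2 ≤ 1 / N) {n : ℕ}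
    (v : Fin n → X) :
    N * productMean (biasedWeight r) (fun ξ => ‖∑ j, (((ξ j : ℤ) : ℝ) - r) • v j‖ ^ q) ≤
      (2 * C) ^ q * signMean fun ε : Cube n => ‖∑ j, ((ε j : ℤ) : ℝ) • v j‖ ^ q := by
  have hN' : (N : ℝ) ≠ 0 := by positivity
  set ν : ℤˣ × Fin N → ℝ := fun _ => 1 / (2 * N : ℝ) with hν
  have hν0 : ∀ o, 0 ≤ ν o := fun _ => by simp only [hν]; positivity
  set d : Fin N → ℤˣ × Fin N → ℝ := fun k o => if o.2 = k then 2 * ((o.1 : ℤ) : ℝ) else 0 with hd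
  have hφ := convexOn_norm_rpow (X := X) hq
  have s1 : ∀ k : Fin N,
      productMean (biasedWeight r) (fun ξ => ‖∑ j, (((ξ j : ℤ) : ℝ) - r) • v j‖ ^ q) ≤
        productMean ν (fun ω => ‖∑ j, d k (ω j) • v j‖ ^ q) := fun k => by
    have := productMean_le_of_convex (biasedWeight_nonneg h0 h1) hν0
      (c := fun u : ℤˣ => ((u : ℤ) : ℝ) - r) (d := d k)
      (fun φ hφ a v => biased_le_selected h0 h1 hN hr k hφ a v) hφ v 0
    simpa only [zero_add] using this
  -- Cotype for the `N` parts. Each index `j` lies in exactly one part, so recombining with signs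
  -- `ε` multiplies `v j` by the sign of its label.
  have s2 : ∀ ω : Fin n → ℤˣ × Fin N, ∑ k, ‖∑ j, d k (ω j) • v j‖ ^ q ≤
      C ^ q * signMean fun ε : Cube N =>
        ‖∑ j, (2 * ((ε (ω j).2 : ℤ) : ℝ) * (((ω j).1 : ℤ) : ℝ)) • v j‖ ^ q := fun ω => by
    refine (hC.2 N fun k => ∑ j, d k (ω j) • v j).trans (le_of_eq ?_)
    rw [expect_eq_signMean]
    congr 2
    ext ε
    congr 2
    simp only [Finset.smul_sum, smul_smul]
    rw [Finset.sum_comm]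
    refine Finset.sum_congr rfl fun j _ => ?_
    rw [← Finset.sum_smul]
    congr 1
    simp only [hd, mul_ite, mul_zero, Finset.sum_ite_eq, Finset.mem_univ, if_true]
    ring
  -- For frozen `ε`, multiplying by the sign of the label leaves the uniform sign uniform.
  have s3 : ∀ ε : Cube N, productMean ν (fun ω : Fin n → ℤˣ × Fin N =>
        ‖∑ j, (2 * ((ε (ω j).2 : ℤ) : ℝ) * (((ω j).1 : ℤ) : ℝ)) • v j‖ ^ q) ≤
      signMean fun ε : Cube n => ‖∑ j, (2 * ((ε j : ℤ) : ℝ)) • v j‖ ^ q := fun ε => by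
    have := productMean_le_of_convex hν0 half_nonneg
      (c := fun o : ℤˣ × Fin N => 2 * ((ε o.2 : ℤ) : ℝ) * ((o.1 : ℤ) : ℝ))
      (d := fun u : ℤˣ => 2 * ((u : ℤ) : ℝ)) (fun φ hφ a v => ?_) hφ v 0
    · simpa only [zero_add] using this
    · rw [Fintype.sum_prod_type_right, Finset.sum_congr rfl (g := fun _ =>
        1 / N * ∑ u : ℤˣ, 1 / 2 * φ (a + (2 * ((u : ℤ) : ℝ)) • v))]
      · rw [Finset.sum_const, Finset.card_univ, Fintype.card_fin, nsmul_eq_mul, ← mul_assoc,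
          mul_one_div_cancel hN', one_mul]
      · intro l _
        simp only [sum_units_int, hν]
        rcases Int.units_eq_one_or (ε l) with h | h
        · simp [h]; field_simp
        · simp [h]; field_simp; ring
  have hC0 : 0 ≤ C := hC.1
  calc N * productMean (biasedWeight r) (fun ξ => ‖∑ j, (((ξ j : ℤ) : ℝ) - r) • v j‖ ^ q)
      = ∑ _k : Fin N,
        productMean (biasedWeight r) (fun ξ => ‖∑ j, (((ξ j : ℤ) : ℝ) - r) • v j‖ ^ q) := by simp
    _ ≤ ∑ k : Fin N, productMean ν (fun ω => ‖∑ j, d k (ω j) • v j‖ ^ q) :=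
        Finset.sum_le_sum fun k _ => s1 k
    _ = productMean ν (fun ω => ∑ k, ‖∑ j, d k (ω j) • v j‖ ^ q) := (productMean_sum _ _ _).symm
    _ ≤ C ^ q * signMean fun ε : Cube N => productMean ν fun ω : Fin n → ℤˣ × Fin N =>
          ‖∑ j, (2 * ((ε (ω j).2 : ℤ) : ℝ) * (((ω j).1 : ℤ) : ℝ)) • v j‖ ^ q := by
        refine (productMean_mono hν0 s2).trans (le_of_eq ?_)
        rw [productMean_const_mul, productMean_comm]
    _ ≤ C ^ q * signMean fun ε : Cube n => ‖∑ j, (2 * ((ε j : ℤ) : ℝ)) • v j‖ ^ q := by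
        refine mul_le_mul_of_nonneg_left ?_ (by positivity)
        exact (productMean_mono half_nonneg s3).trans (le_of_eq (productMean_const sum_half _))
    _ = _ := by
        simp only [mul_smul, ← Finset.smul_sum, norm_smul]
        simp only [Real.mul_rpow (norm_nonneg _) (norm_nonneg _), productMean_const_mul]
        rw [Real.mul_rpow zero_le_two hC0, Real.norm_of_nonneg zero_le_two]
        ring

/-- The largest `N` allowed by the splitting is `⌊2 / (1 - r ^ 2)⌋₊`; it is still at least `1 / (1 -
r ^ 2)`, which gives the factor `1 - r ^ 2`. -/
theorem IsCotypeBound.biased_le {q C : ℝ} (hq : 1 ≤ q) (hC : IsCotypeBound X q C) {r : ℝ}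
    (h0 : 0 ≤ r) (h1 : r < 1) {n : ℕ} (v : Fin n → X) :
    productMean (biasedWeight r) (fun ξ => ‖∑ j, (((ξ j : ℤ) : ℝ) - r) • v j‖ ^ q) ≤
      (1 - r ^ 2) * ((2 * C) ^ q * signMean fun ε : Cube n => ‖∑ j, ((ε j : ℤ) : ℝ) • v j‖ ^ q) := by
  have hr : 0 < 1 - r ^ 2 := by nlinarith
  have hr1 : 1 - r ^ 2 ≤ 1 := by nlinarith
  set N := ⌊2 / (1 - r ^ 2)⌋₊ with hNdef
  have f1 : (N : ℝ) ≤ 2 / (1 - r ^ 2) := Nat.floor_le (by positivity)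
  have f2 : 2 / (1 - r ^ 2) < N + 1 := Nat.lt_floor_add_one _
  rw [le_div_iff₀ hr] at f1
  rw [div_lt_iff₀ hr] at f2
  have hNr : 1 ≤ N * (1 - r ^ 2) := by linarith
  have hN0 : 0 < N := by
    rcases Nat.eq_zero_or_pos N with h | h
    · rw [h] at hNr; norm_num at hNr
    · exact h
  have hN' : (0 : ℝ) < N := by exact_mod_cast hN0
  have key := hC.mul_biased_le hq h0 h1.le hN0
    (by rw [le_div_iff₀ hN']; linarith) v
  have hP : 0 ≤ productMean (biasedWeight r)
      (fun ξ : Fin n → ℤˣ => ‖∑ j, (((ξ j : ℤ) : ℝ) - r) • v j‖ ^ q) :=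
    productMean_nonneg (biasedWeight_nonneg h0 h1.le) fun _ => by positivity
  have := mul_le_mul_of_nonneg_left key hr.le
  nlinarith

/-! ### The noise operator and the heat semigroup -/

theorem flip_flip {n : ℕ} (j : Fin n) (x : Cube n) : flip j (flip j x) = x := by
  simp [flip]

theorem flip_mul {n : ℕ} (j : Fin n) (x y : Cube n) : flip j x * y = flip j (x * y) := by
  ext i
  by_cases h : i = j
  · subst h; simp [flip]
  · simp [flip, h]

theorem mul_flip {n : ℕ} (j : Fin n) (x y : Cube n) : x * flip j y = flip j (x * y) := by
  rw [mul_comm, flip_mul, mul_comm]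

theorem sum_eq_zero_of_flip {n : ℕ} (j : Fin n) (g : Cube n → X)
    (h : ∀ x, g (flip j x) = -g x) : ∑ x, g x = 0 := by
  have e : ∑ x, g x = ∑ x, g (flip j x) :=
    (Equiv.sum_comp (Function.Involutive.toPerm (flip j) (flip_flip j)) g).symm
  simp only [h, Finset.sum_neg_distrib] at e
  rw [eq_neg_iff_add_eq_zero, ← two_smul ℝ] at e
  exact (smul_eq_zero.1 e).resolve_left two_ne_zero

theorem D_flip {n : ℕ} (j : Fin n) (f : Cube n → X) (x : Cube n) :
    D j f (flip j x) = -D j f x := by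
  rw [D_apply, D_apply, flip_flip]; module

/-- The product weight on the cube omitting the coordinate `j`. -/
noncomputable def weightErase {n : ℕ} (r : ℝ) (j : Fin n) (ξ : Cube n) : ℝ :=
  ∏ i ∈ Finset.univ.erase j, biasedWeight r (ξ i)

theorem weightErase_flip {n : ℕ} (r : ℝ) (j : Fin n) (ξ : Cube n) :
    weightErase r j (flip j ξ) = weightErase r j ξ :=
  Finset.prod_congr rfl fun i hi => by simp [flip, Finset.ne_of_mem_erase hi]

theorem biasedWeight_mul_weightErase {n : ℕ} (r : ℝ) (j : Fin n) (ξ : Cube n) :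
    biasedWeight r (ξ j) * weightErase r j ξ = ∏ i, biasedWeight r (ξ i) :=
  Finset.mul_prod_erase _ (fun i => biasedWeight r (ξ i)) (Finset.mem_univ j)

theorem coe_flip_self {n : ℕ} (j : Fin n) (ξ : Cube n) :
    ((flip j ξ j : ℤ) : ℝ) = -((ξ j : ℤ) : ℝ) := by simp [flip]

/-- The noise operator on the cube. -/
noncomputable def noise (r : ℝ) {n : ℕ} (f : Cube n → X) : Cube n → X :=
  fun x => ∑ ξ : Cube n, (∏ i, biasedWeight r (ξ i)) • f (ξ * x)

/-- The derivative of the noise operator in the parameter. -/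
noncomputable def noiseDeriv (r : ℝ) {n : ℕ} (f : Cube n → X) : Cube n → X :=
  fun x => ∑ j, ∑ ξ : Cube n, (weightErase r j ξ * (((ξ j : ℤ) : ℝ) / 2)) • D j f (ξ * x)

theorem noise_one {n : ℕ} (f : Cube n → X) : noise 1 f = f := by
  ext x
  rw [noise, Finset.sum_eq_single 1]
  · simp [biasedWeight_one]
  · intro ξ _ hξ
    obtain ⟨i, hi⟩ : ∃ i, ξ i ≠ 1 := by
      by_contra! h
      exact hξ (funext h)
    rw [Finset.prod_eq_zero (Finset.mem_univ i), zero_smul]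
    rw [(Int.units_eq_one_or (ξ i)).resolve_left hi, biasedWeight_neg_one]
    norm_num
  · simp

theorem hasDerivAt_noise (r : ℝ) {n : ℕ} (f : Cube n → X) :
    HasDerivAt (fun r => noise r f) (noiseDeriv r f) r := by
  rw [hasDerivAt_pi]
  intro x
  have hw : ∀ ξ : Cube n, HasDerivAt (fun r => ∏ i, biasedWeight r (ξ i))
      (∑ j, weightErase r j ξ * (((ξ j : ℤ) : ℝ) / 2)) r := fun ξ => by
    have := HasDerivAt.fun_finsetProd (u := Finset.univ) (x := r)
      (f := fun i r => biasedWeight r (ξ i)) (f' := fun i => ((ξ i : ℤ) : ℝ) / 2) fun i _ => by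
        exact ((((hasDerivAt_id r).mul_const ((ξ i : ℤ) : ℝ)).const_add 1).div_const 2).congr_deriv
          (by rw [one_mul])
    exact this
  have h := HasDerivAt.fun_sum (u := Finset.univ) fun ξ _ => (hw ξ).smul_const (f (ξ * x))
  refine h.congr_deriv ?_
  simp only [noiseDeriv, Finset.sum_smul]
  rw [Finset.sum_comm]
  refine Finset.sum_congr rfl fun j _ => ?_
  -- The weight is odd under `flip j`, so `f` may be replaced by its odd part `D j f`.
  rw [← sub_eq_zero, ← Finset.sum_sub_distrib]
  refine sum_eq_zero_of_flip j _ fun ξ => ?_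
  rw [weightErase_flip, coe_flip_self, flip_mul, D_flip, D_apply]
  module

/-- `D j` passes through the average. Of the weight `(1 + r * ξ j) / 2`, only the part odd in `ξ j`
survives against the odd function `D j f`. -/
theorem laplacian_noise (r : ℝ) {n : ℕ} (f : Cube n → X) :
    laplacian n X (noise r f) = r • noiseDeriv r f := by
  ext x
  simp only [laplacian, sum_apply, Finset.sum_apply, Pi.smul_apply, noiseDeriv,
    Finset.smul_sum]
  refine Finset.sum_congr rfl fun j _ => ?_
  have e : D j (noise r f) x = ∑ ξ : Cube n, (∏ i, biasedWeight r (ξ i)) • D j f (ξ * x) := by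
    simp only [D_apply, noise, mul_flip, ← Finset.sum_sub_distrib, Finset.smul_sum, ← smul_sub]
    simp only [smul_comm (1 / 2 : ℝ)]
  rw [e, ← sub_eq_zero, ← Finset.sum_sub_distrib]
  refine sum_eq_zero_of_flip j _ fun ξ => ?_
  rw [← biasedWeight_mul_weightErase r j, ← biasedWeight_mul_weightErase r j, weightErase_flip,
    biasedWeight, biasedWeight, coe_flip_self, flip_mul, D_flip]
  module

/-- Since `ξ j = ±1`, `(1 + r * ξ j) * (ξ j - r) = (1 - r ^ 2) * ξ j`. This restores the full
probability weight, as Jensen requires, with centred coefficients. -/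
theorem noiseDeriv_eq {r : ℝ} (hr : 1 - r ^ 2 ≠ 0) {n : ℕ} (f : Cube n → X) :
    noiseDeriv r f = (1 - r ^ 2)⁻¹ • fun x => ∑ ξ : Cube n, (∏ i, biasedWeight r (ξ i)) •
      ∑ j, (((ξ j : ℤ) : ℝ) - r) • D j f (ξ * x) := by
  ext x
  simp only [noiseDeriv, Pi.smul_apply, Finset.smul_sum]
  rw [Finset.sum_comm]
  refine Finset.sum_congr rfl fun ξ _ => Finset.sum_congr rfl fun j _ => ?_
  rw [← biasedWeight_mul_weightErase r j, smul_smul, smul_smul]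
  congr 1
  rw [mul_assoc, eq_inv_mul_iff_mul_eq₀ hr, biasedWeight]
  rcases Int.units_eq_one_or (ξ j) with h | h <;> simp [h] <;> ring

/-- By `laplacian_noise`, `noise (exp (-t)) f` solves the heat equation, so applying `exp (t • L)`
to it gives a constant, equal to `f` at `t = 0`. -/
theorem heat_eq_noise [CompleteSpace X] (t : ℝ) {n : ℕ} (f : Cube n → X) :
    heat t f = noise (Real.exp (-t)) f := by
  set L := laplacian n X with hL
  have hd : ∀ t : ℝ, HasDerivAt
      (fun t : ℝ => NormedSpace.exp (t • L) (noise (Real.exp (-t)) f)) 0 t := fun t => by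
    have h1 := hasDerivAt_exp_smul_const (𝕂 := ℝ) L t
    have h2 : HasDerivAt (fun t : ℝ => noise (Real.exp (-t)) f)
        (-(L (noise (Real.exp (-t)) f))) t := by
      refine ((hasDerivAt_noise (Real.exp (-t)) f).scomp t (hasDerivAt_neg t).exp).congr_deriv ?_
      rw [hL, laplacian_noise]
      module
    refine (h1.clm_apply h2).congr_deriv ?_
    rw [map_neg]
    exact add_neg_cancel _
  have hc := is_const_of_deriv_eq_zero (fun t => (hd t).differentiableAt)
    (fun t => (hd t).deriv) t 0
  simp only [zero_smul, NormedSpace.exp_zero, neg_zero, Real.exp_zero, noise_one] at hc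
  let _ : NormedAlgebra ℚ ((Cube n → X) →L[ℝ] (Cube n → X)) := NormedAlgebra.restrictScalars ℚ ℝ _
  have hmul : NormedSpace.exp ((-t) • L) * NormedSpace.exp (t • L) = 1 := by
    rw [← NormedSpace.exp_add_of_commute
      (((Commute.refl L).smul_left (-t)).smul_right t), ← add_smul, neg_add_cancel, zero_smul,
      NormedSpace.exp_zero]
  have : heat t (NormedSpace.exp (t • L) (noise (Real.exp (-t)) f)) = noise (Real.exp (-t)) f := by
    rw [heat, ← mul_apply_eq_comp, hmul, one_apply_eq_self]
  rw [← this, hc]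
  rfl

/-! ### Norm estimates and integration in the noise parameter -/

theorem cubeNorm_eq {Y : Type*} [NormedAddCommGroup Y] {p : ℝ} {n : ℕ}
    (f : Cube n → Y) :
    cubeNorm p f = (signMean fun x => ‖f x‖ ^ p) ^ (1 / p) := by
  rw [cubeNorm, expect_eq_signMean]

theorem gradNorm_eq {p : ℝ} {n : ℕ} (f : Cube n → X) :
    gradNorm p f = (signMean fun x => signMean fun ε : Cube n =>
      ‖∑ j, ((ε j : ℤ) : ℝ) • D j f x‖ ^ p) ^ (1 / p) := by
  rw [gradNorm]
  simp only [expect_eq_signMean]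

theorem gradNorm_nonneg (p : ℝ) {n : ℕ} (f : Cube n → X) : 0 ≤ gradNorm p f := by
  rw [gradNorm_eq]
  exact Real.rpow_nonneg (productMean_nonneg half_nonneg fun _ =>
    productMean_nonneg half_nonneg fun _ => by positivity) _

theorem cubeNorm_smul {p : ℝ} (hp : 0 < p) {n : ℕ} (c : ℝ) (f : Cube n → X) :
    cubeNorm p (c • f) = |c| * cubeNorm p f := by
  have h0 : 0 ≤ signMean fun x => ‖f x‖ ^ p :=
    productMean_nonneg half_nonneg fun _ => by positivity
  rw [cubeNorm_eq, cubeNorm_eq]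
  simp only [Pi.smul_apply, norm_smul, Real.norm_eq_abs,
    Real.mul_rpow (abs_nonneg _) (norm_nonneg _), productMean_const_mul]
  rw [Real.mul_rpow (by positivity) h0, one_div, Real.rpow_rpow_inv (abs_nonneg _) hp.ne']

/-- Up to a constant, `cubeNorm` is the norm of a normed space, where the mean value inequality is
available. -/
theorem cubeNorm_eq_norm_toLp {p : ℝ} (hp : 0 < p) {n : ℕ} (f : Cube n → X) :
    cubeNorm p f = ((1 / 2 : ℝ) ^ n) ^ (1 / p) * ‖WithLp.toLp (ENNReal.ofReal p) f‖ := by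
  have h : (ENNReal.ofReal p).toReal = p := ENNReal.toReal_ofReal hp.le
  rw [PiLp.norm_eq_sum (by rwa [h]), h, cubeNorm_eq, ← Real.mul_rpow (by positivity)
    (Finset.sum_nonneg fun _ _ => by positivity), signMean, productMean, Finset.mul_sum]
  simp

theorem rpow_productMean_le {Ω : Type*} [Fintype Ω] {μ : Ω → ℝ} (hμ : ∀ o, 0 ≤ μ o)
    (h1 : ∑ o, μ o = 1) {n : ℕ} {g : (Fin n → Ω) → ℝ} (hg : ∀ ω, 0 ≤ g ω) {p : ℝ} (hp : 1 ≤ p) :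
    productMean μ g ^ p ≤ productMean μ fun ω => g ω ^ p :=
  Real.rpow_arith_mean_le_arith_mean_rpow Finset.univ _ _
    (fun _ _ => Finset.prod_nonneg fun _ _ => hμ _) (sum_prod_weight h1 n) (fun ω _ => hg ω) hp

theorem signMean_mul_left {n : ℕ} (ξ : Cube n) (F : Cube n → ℝ) :
    (signMean fun x => F (ξ * x)) = signMean F := by
  simp only [signMean, productMean, Finset.prod_const]
  exact Equiv.sum_comp (Equiv.mulLeft ξ) fun x => _ * F x

theorem IsCotypeBound.cubeNorm_noiseDeriv_le {q C : ℝ} (hq : 2 ≤ q) (hC : IsCotypeBound X q C)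
    {p : ℝ} (hp : 1 ≤ p) (hpq : p ≤ q) {r : ℝ} (h0 : 0 ≤ r) (h1 : r < 1) {n : ℕ}
    (f : Cube n → X) :
    cubeNorm p (noiseDeriv r f) ≤
      6 * C * Real.sqrt (2 * q) * gradNorm p f * (1 - r) ^ (1 / q - 1) := by
  have hr : 0 < 1 - r ^ 2 := by nlinarith
  have hp0 : 0 < p := by linarith
  have hq0 : 0 < q := by linarith
  have hC0 := hC.1
  -- The factors come from the biased sum, the cotype splitting and Kahane–Khintchine.
  set B : ℝ := (1 - r ^ 2) ^ (1 / q) * (2 * C) * (3 * Real.sqrt (2 * q)) with hB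
  have hB0 : 0 ≤ B := by positivity
  set H : Cube n → X := fun x => ∑ ξ : Cube n, (∏ i, biasedWeight r (ξ i)) •
      ∑ j, (((ξ j : ℤ) : ℝ) - r) • D j f (ξ * x) with hH
  have hw := biasedWeight_nonneg h0 h1.le
  have jensen : ∀ x, ‖H x‖ ^ p ≤ productMean (biasedWeight r)
      fun ξ : Cube n => ‖∑ j, (((ξ j : ℤ) : ℝ) - r) • D j f (ξ * x)‖ ^ p := fun x => by
    refine le_trans (Real.rpow_le_rpow (norm_nonneg _) ?_ hp0.le)
      (rpow_productMean_le hw (sum_biasedWeight r) (fun _ => norm_nonneg _) hp)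
    refine (norm_sum_le _ _).trans (Finset.sum_le_sum fun ξ _ => ?_)
    rw [norm_smul, Real.norm_of_nonneg (Finset.prod_nonneg fun _ _ => hw _)]
  have pointwise : ∀ x, productMean (biasedWeight r)
      (fun ξ : Cube n => ‖∑ j, (((ξ j : ℤ) : ℝ) - r) • D j f x‖ ^ p) ≤
        B ^ p * signMean fun ε : Cube n => ‖∑ j, ((ε j : ℤ) : ℝ) • D j f x‖ ^ p := fun x => by
    set m := signMean fun ε : Cube n => ‖∑ j, ((ε j : ℤ) : ℝ) • D j f x‖ with hm
    have hm0 : 0 ≤ m := productMean_nonneg half_nonneg fun _ => norm_nonneg _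
    have key : productMean (biasedWeight r)
        (fun ξ : Cube n => ‖∑ j, (((ξ j : ℤ) : ℝ) - r) • D j f x‖ ^ q) ≤ (B * m) ^ q := by
      refine (hC.biased_le (by linarith) h0 h1 fun j => D j f x).trans ?_
      have hk := kahane_khintchine hq fun j => D j f x
      rw [← hm] at hk
      have e : (B * m) ^ q = (1 - r ^ 2) * ((2 * C) ^ q * (3 * Real.sqrt (2 * q) * m) ^ q) := by
        rw [hB, mul_assoc _ _ m, mul_assoc _ (2 * C), Real.mul_rpow (by positivity) (by positivity),
          Real.mul_rpow (x := 2 * C) (by positivity) (by positivity), one_div,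
          Real.rpow_inv_rpow hr.le hq0.ne']
      rw [e]
      gcongr
    refine (productMean_rpow_le hw (sum_biasedWeight r) (fun _ => norm_nonneg _) hp0 hpq
      (by positivity) key).trans ?_
    rw [Real.mul_rpow hB0 hm0]
    exact mul_le_mul_of_nonneg_left
      (rpow_productMean_le half_nonneg sum_half (fun _ => norm_nonneg _) hp) (by positivity)
  have total : (signMean fun x => ‖H x‖ ^ p) ≤ B ^ p * signMean fun x => signMean fun ε : Cube n =>
      ‖∑ j, ((ε j : ℤ) : ℝ) • D j f x‖ ^ p := by
    refine (productMean_mono half_nonneg jensen).trans ?_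
    -- With `ξ` outermost, the translation `x ↦ ξ * x` can be removed for each `ξ`.
    rw [productMean_comm]
    have e : ∀ ξ : Cube n, (signMean fun x => ‖∑ j, (((ξ j : ℤ) : ℝ) - r) • D j f (ξ * x)‖ ^ p) =
        signMean fun x => ‖∑ j, (((ξ j : ℤ) : ℝ) - r) • D j f x‖ ^ p := fun ξ =>
      signMean_mul_left ξ fun x => ‖∑ j, (((ξ j : ℤ) : ℝ) - r) • D j f x‖ ^ p
    simp only [e]
    rw [productMean_comm, ← productMean_const_mul]
    exact productMean_mono half_nonneg pointwise
  have hHB : cubeNorm p H ≤ B * gradNorm p f := by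
    have hS0 : 0 ≤ signMean fun x => signMean fun ε : Cube n =>
        ‖∑ j, ((ε j : ℤ) : ℝ) • D j f x‖ ^ p :=
      productMean_nonneg half_nonneg fun _ => productMean_nonneg half_nonneg fun _ => by positivity
    rw [cubeNorm_eq, gradNorm_eq]
    refine (Real.rpow_le_rpow (productMean_nonneg half_nonneg fun _ => by positivity) total
      (by positivity)).trans (le_of_eq ?_)
    rw [Real.mul_rpow (by positivity) hS0, one_div, Real.rpow_rpow_inv hB0 hp0.ne']
  rw [noiseDeriv_eq hr.ne', cubeNorm_smul hp0, abs_of_nonneg (by positivity)]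
  refine (mul_le_mul_of_nonneg_left hHB (by positivity)).trans ?_
  have e : (1 - r ^ 2)⁻¹ * (B * gradNorm p f) =
      6 * C * Real.sqrt (2 * q) * gradNorm p f * (1 - r ^ 2) ^ (1 / q - 1) := by
    rw [hB, Real.rpow_sub hr, Real.rpow_one]
    field_simp
    ring
  rw [e]
  have hg := gradNorm_nonneg p f
  refine mul_le_mul_of_nonneg_left ?_ (by positivity)
  -- The exponent `1 / q - 1` is nonpositive and `1 - r ≤ 1 - r ^ 2`.
  refine Real.rpow_le_rpow_of_nonpos (by linarith) (by nlinarith) ?_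
  rw [sub_nonpos, div_le_one hq0]
  linarith

theorem IsCotypeBound.cubeNorm_sub_noise_le {q C : ℝ} (hq : 2 ≤ q) (hC : IsCotypeBound X q C)
    {p : ℝ} (hp : 1 ≤ p) (hpq : p ≤ q) {r : ℝ} (h0 : 0 ≤ r) (h1 : r ≤ 1) {n : ℕ}
    (f : Cube n → X) :
    cubeNorm p (f - noise r f) ≤
      6 * C * Real.sqrt (2 * q) * gradNorm p f * (q * (1 - r) ^ (1 / q)) := by
  have hp0 : 0 < p := by linarith
  have hq0 : 0 < q := by linarith
  have : Fact (1 ≤ ENNReal.ofReal p) := ⟨by simpa using hp⟩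
  set A : ℝ := 6 * C * Real.sqrt (2 * q) * gradNorm p f
  set c : ℝ := ((1 / 2 : ℝ) ^ n) ^ (1 / p) with hc
  have hc0 : 0 < c := by positivity
  let L := (PiLp.continuousLinearEquiv (ENNReal.ofReal p) ℝ (fun _ : Cube n => X)).symm
  have hL : ∀ g : Cube n → X, ‖c • L g‖ = cubeNorm p g := fun g => by
    rw [norm_smul, Real.norm_of_nonneg hc0.le, cubeNorm_eq_norm_toLp hp0]
    rfl
  have hd : ∀ s : ℝ, HasDerivAt (fun s => c • L (noise s f - noise r f))
      (c • L (noiseDeriv s f)) s := fun s =>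
    ((L.hasFDerivAt.comp_hasDerivAt s ((hasDerivAt_noise s f).sub_const (noise r f)))).const_smul c
  -- The comparison function is the integral of `A * (1 - s) ^ (1 / q - 1)` from `r`. The integrand
  -- may blow up at `s = 1`, but the derivative bound is needed only on `[r, 1)`.
  have key := image_norm_le_of_norm_deriv_right_le_deriv_boundary' (a := r) (b := 1)
    (f := fun s => c • L (noise s f - noise r f)) (f' := fun s => c • L (noiseDeriv s f))
    (B := fun s => A * (q * (1 - r) ^ (1 / q) - q * (1 - s) ^ (1 / q)))
    (B' := fun s => A * (1 - s) ^ (1 / q - 1))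
    (fun s _ => (hd s).continuousAt.continuousWithinAt) (fun s _ => (hd s).hasDerivWithinAt)
    (by simp) ?_ ?_ ?_ (Set.right_mem_Icc.2 h1)
  · rw [hL, noise_one] at key
    simpa [Real.zero_rpow (inv_ne_zero hq0.ne')] using key
  · have : Continuous fun s : ℝ => (1 - s) ^ (1 / q) :=
      (continuous_const.sub continuous_id).rpow_const fun _ => Or.inr (by positivity)
    exact (continuous_const.mul (continuous_const.sub (continuous_const.mul this))).continuousOn
  · intro s hs
    have h1s : 0 < 1 - s := by linarith [hs.2]
    have h := (((((hasDerivAt_id s).const_sub 1).rpow_const (p := 1 / q)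
      (Or.inl h1s.ne')).const_mul q).const_sub (q * (1 - r) ^ (1 / q))).const_mul A
    refine (h.congr_deriv ?_).hasDerivWithinAt
    simp only [id]
    field_simp
  · intro s hs
    rw [hL]
    exact hC.cubeNorm_noiseDeriv_le hq hp hpq (h0.trans hs.1) hs.2 f

/-- The best cotype constant is itself admissible. -/
theorem isCotypeBound_cotypeConst {q : ℝ} (hq : 0 < q) (h : HasCotype X q) :
    IsCotypeBound X q (cotypeConst X q) := by
  -- Each cotype inequality is a closed condition on `C`, so the infimum is attained.
  have hcl : IsClosed {C : ℝ | IsCotypeBound X q C} := by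
    have : {C : ℝ | IsCotypeBound X q C} = Set.Ici 0 ∩ ⋂ (m : ℕ) (v : Fin m → X),
        {C : ℝ | ∑ j, ‖v j‖ ^ q ≤
          C ^ q * Finset.univ.expect fun ε : Cube m => ‖∑ j, ((ε j : ℤ) : ℝ) • v j‖ ^ q} := by
      ext C
      simp [IsCotypeBound]
    rw [this]
    refine isClosed_Ici.inter (isClosed_iInter fun m => isClosed_iInter fun v =>
      isClosed_le continuous_const (Continuous.mul ?_ continuous_const))
    exact continuous_id.rpow_const fun _ => Or.inr hq.le
  exact hcl.csInf_mem h ⟨0, fun C hC => hC.1⟩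

end HammingCube

theorem mainTheorem9 :
    ∃ K : ℝ, 0 < K ∧
      ∀ (X : Type*) [NormedAddCommGroup X] [NormedSpace ℝ X] [CompleteSpace X]
        (q : ℝ), 2 ≤ q → HammingCube.HasCotype X q →
      ∀ p : ℝ, 1 ≤ p → p ≤ 2 →
      ∀ (n : ℕ) (f : HammingCube.Cube n → X) (t : ℝ), 0 ≤ t →
        HammingCube.cubeNorm p (f - HammingCube.heat t f) ≤
          K * HammingCube.cotypeConst X q * q ^ (3 / 2 : ℝ) *
            (1 - Real.exp (-2 * t)) ^ (1 / q) * HammingCube.gradNorm p f := by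
  refine ⟨6 * Real.sqrt 2, by positivity, fun X _ _ _ q hq hX p hp hp2 n f t ht => ?_⟩
  have hq0 : 0 < q := by linarith
  have hC := HammingCube.isCotypeBound_cotypeConst hq0 hX
  have hC0 := hC.1
  have hg := HammingCube.gradNorm_nonneg p f
  have hr0 : 0 ≤ Real.exp (-t) := (Real.exp_pos _).le
  have hr1 : Real.exp (-t) ≤ 1 := Real.exp_le_one_iff.2 (by linarith)
  have he : Real.exp (-2 * t) = Real.exp (-t) ^ 2 := by
    rw [← Real.exp_nat_mul]
    congr 1
    push_cast
    ring
  rw [HammingCube.heat_eq_noise, he]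
  refine (hC.cubeNorm_sub_noise_le hq hp (hp2.trans hq) hr0 hr1 f).trans ?_
  -- The argument gives `1 - exp (-t)`, which is at most `1 - exp (-2 * t)`.
  have hmono : (1 - Real.exp (-t)) ^ (1 / q) ≤ (1 - Real.exp (-t) ^ 2) ^ (1 / q) :=
    Real.rpow_le_rpow (by linarith) (by nlinarith) (by positivity)
  have hpow : q ^ (3 / 2 : ℝ) = Real.sqrt q * q := by
    rw [Real.sqrt_eq_rpow, ← Real.rpow_add_one hq0.ne']
    norm_num
  rw [hpow, Real.sqrt_mul zero_le_two]
  calc _ = 6 * Real.sqrt 2 * HammingCube.cotypeConst X q * (Real.sqrt q * q) *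
        (1 - Real.exp (-t)) ^ (1 / q) * HammingCube.gradNorm p f := by ring
    _ ≤ _ := by gcongr
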